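/- Let $n\ge 2$ and let $\Gamma$ be the quiver with vertices $(i,j)$, $1\le i\le n+1$, $1\le j\le n$, and with arrows $(i,j)\to(i+1,j)$ and $(i,j)\to(i,j+1)$ (whenever both ends are vertices), subject to the relations that all squares commute. Let $M$ be the representation of $\Gamma$ with $M_{i,j}=\mathbb{C}^i$, in which the arrow $(i,j)\to(i+1,j)$ acts as the inclusion $\mathbb{C}^i\to\mathbb{C}^{i+1}$ onto the span of the first $i$ basis vectors and the arrow $(i,j)\to(i,j+1)$ acts as the identity. For a permutation $w\in S_{n+1}$ put $r^w_{p,q}=\#\{k\le q: w(k)\le p\}$, and define the dimension vector $\mathbf{e}^w=(e^w_{i,j})$, $1\le i\le n+1$, $1\le j\le n$, recursively by $$e^w_{i,j}=\begin{cases} r^w_{i,j} & \text{if } r^w_{i,j}=\min\{i,j\}\text{ or } r^w_{i,j}=0,\\ \max\{e^w_{i-1,j},\,e^w_{i,j-1}\} & \text{if } 0<r^w_{i,j}<\min\{i,j\}.\end{cases}$$ Let $\mathrm{Gr}_{\mathbf{e}^w}(M)$ be the quiver Grassmannian of all subrepresentations $N=(N_{i,j})$ of $M$ with $\dim N_{i,j}=e^w_{i,j}$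 for all $(i,j)$, a closed subvariety of $\prod_{i,j}\mathrm{Gr}(e^w_{i,j},\mathbb{C}^i)$. Let $F_p\subseteq\mathbb{C}^{n+1}$ be the span of the first $p$ basis vectors, and let $$X_w=\{V_1\subseteq\dots\subseteq V_n\subseteq V_{n+1}=\mathbb{C}^{n+1}\;:\;\dim V_q=q,\ \dim(F_p\cap V_q)\ge r^w_{p,q}\text{ for all }1\le p,q\le n+1\}$$ be the Schubert variety of $w$ in the variety of complete flags in $\mathbb{C}^{n+1}$. If $w$ avoids the patterns $[4231]$ and $[3412]$, that is, if no four-term subsequence of $w(1),\dots,w(n+1)$ has the same relative order as $4,2,3,1$ or as $3,4,1,2$, then the map $$\mathrm{Gr}_{\mathbf{e}^w}(M)\to X_w,\qquad N\mapsto\bigl(N_{n+1,1}\subseteq N_{n+1,2}\subseteq\dots\subseteq N_{n+1,n}\bigr),$$ is well defined and is an isomorphism of projective varieties. -/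

import Mathlib

/-! ### Products of Grassmannians and their subvarieties -/

/-- A point of the product of Grassmannians `∏ v, Gr (d v, ℂ ^ (m v))`: a family of linear
subspaces of the spaces `ℂ ^ (m v)`, of dimension `d v`. -/
@[ext]
structure MultiGrassmannian {ι : Type} (m d : ι → ℕ) where
  space : ∀ v, Submodule ℂ (Fin (m v) → ℂ)
  finrank_space : ∀ v, Module.finrank ℂ (space v) = d v

namespace MultiGrassmannian

variable {ι : Type} {m d : ι → ℕ}

/-- `A` is a family of bases of the subspaces in `N`: the columns of the `m v × d v` matrix `A v`
span `N.space v` (and they are independent, as `N.space v` has dimension `d v`). -/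
def IsFrame (N : MultiGrassmannian m d) (A : ∀ v, Matrix (Fin (m v)) (Fin (d v)) ℂ) : Prop :=
  ∀ v, Submodule.span ℂ (Set.range fun k : Fin (d v) => fun r => A v r k) = N.space v

/-- Index set of the Plücker coordinates: a factor `v` and a `d v`-element set of rows, given as an
increasing sequence. -/
abbrev PluckerIndex (m d : ι → ℕ) : Type := Σ v : ι, (Fin (d v) ↪o Fin (m v))

/-- The Plücker coordinates (maximal minors) of a family of matrices. -/
noncomputable def plucker (A : ∀ v, Matrix (Fin (m v)) (Fin (d v)) ℂ) (x : PluckerIndex m d) : ℂ :=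
  ((A x.1).submatrix x.2 id).det

/-- `p` is multihomogeneous of multidegree `k`: for each factor `v` it is homogeneous of degree
`k v` in the Plücker coordinates that belong to `v`. -/
def IsMultihomogeneous (p : MvPolynomial (PluckerIndex m d) ℂ) (k : ι →₀ ℕ) : Prop :=
  MvPolynomial.IsWeightedHomogeneous (fun x : PluckerIndex m d => Finsupp.single x.1 1) p k

/-- The points of the product of Grassmannians at which `p` does not vanish. For multihomogeneous
`p` this does not depend on the choice of the frame. -/
def nonvanishing (p : MvPolynomial (PluckerIndex m d) ℂ) : Set (MultiGrassmannian m d) :=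
  {N | ∀ A, N.IsFrame A → MvPolynomial.eval (plucker A) p ≠ 0}

/-- The Zariski topology of the product of Grassmannians in its (multi)projective Plücker
embedding: the nonvanishing loci of multihomogeneous polynomials form a base of it. -/
instance zariskiTopology : TopologicalSpace (MultiGrassmannian m d) :=
  TopologicalSpace.generateFrom {U | ∃ p k, IsMultihomogeneous p k ∧ U = nonvanishing p}

/-- `f` is a regular function on the subset `U` (meant to be open) of the subvariety `Z`: each point
of `U` has a neighbourhood in `U` on which `f` is a quotient of two multihomogeneous polynomials of
the same multidegree in the Plücker coordinates, the denominator vanishing nowhere on this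
neighbourhood. The values of `f` outside `U` do not matter. -/
def IsRegularOn {Z : Set (MultiGrassmannian m d)} (f : Z → ℂ) (U : Set Z) : Prop :=
  ∀ N ∈ U, ∃ O : Set Z, IsOpen O ∧ N ∈ O ∧ O ⊆ U ∧
    ∃ (k : ι →₀ ℕ) (p q : MvPolynomial (PluckerIndex m d) ℂ),
      IsMultihomogeneous p k ∧ IsMultihomogeneous q k ∧
        ∀ N' ∈ O, ∀ A, (N' : MultiGrassmannian m d).IsFrame A →
          MvPolynomial.eval (plucker A) q ≠ 0 ∧
            f N' = MvPolynomial.eval (plucker A) p / MvPolynomial.eval (plucker A) q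

end MultiGrassmannian

/-- An isomorphism between (classical, reduced) subvarieties of products of Grassmannians: a
homeomorphism for the Zariski topologies that identifies the regular functions on corresponding
open sets. -/
structure VarietyIso {ι ι' : Type} {m d : ι → ℕ} {m' d' : ι' → ℕ}
    (X : Set (MultiGrassmannian m d)) (Y : Set (MultiGrassmannian m' d')) where
  toHomeomorph : X ≃ₜ Y
  regular_iff : ∀ U : Set Y, IsOpen U → ∀ f : Y → ℂ,
    MultiGrassmannian.IsRegularOn f U ↔
      MultiGrassmannian.IsRegularOn (f ∘ toHomeomorph) (toHomeomorph ⁻¹' U)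

/-! ### Quiver representations and quiver Grassmannians -/

/-- A finite-dimensional complex representation of a quiver on coordinate spaces `ℂ ^ (dim a)`. -/
structure CoordRep (V : Type) [Quiver.{0} V] where
  dim : V → ℕ
  map : ∀ {a b : V}, (a ⟶ b) → ((Fin (dim a) → ℂ) →ₗ[ℂ] (Fin (dim b) → ℂ))

/-- The quiver Grassmannian of `M` for the dimension vector `e`: all subrepresentations of `M` of
dimension vector `e`, as a subvariety of the product of Grassmannians `∏ a, Gr (e a, M a)`. -/
def quiverGrassmannian {V : Type} [Quiver.{0} V] (M : CoordRep V) (e : V → ℕ) :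
    Set (MultiGrassmannian M.dim e) :=
  {N | ∀ (a b : V) (α : a ⟶ b), (N.space a).map (M.map α) ≤ N.space b}

/-! ### The grid quiver and its representation

Rows and columns are counted from `0` in the types `Fin _`: the vertex `⟨i, j⟩` below is the vertex
`(i + 1, j + 1)` in the usual counting from `1`. -/

/-- The vertices of the grid quiver: `n + 1` rows and `n` columns. -/
structure GridVertex (n : ℕ) where
  row : Fin (n + 1)
  col : Fin n

/-- The arrows of the grid quiver: `(i, j) ⟶ (i + 1, j)` and `(i, j) ⟶ (i, j + 1)`. -/
inductive GridArrow (n : ℕ) : GridVertex n → GridVertex n → Type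
  | down (i : Fin n) (j : Fin n) : GridArrow n ⟨i.castSucc, j⟩ ⟨i.succ, j⟩
  | right (i : Fin (n + 1)) (j : Fin n) (hj : j.val + 1 < n) :
      GridArrow n ⟨i, j⟩ ⟨i, ⟨j.val + 1, hj⟩⟩

instance gridQuiver (n : ℕ) : Quiver.{0} (GridVertex n) := ⟨GridArrow n⟩

/-- The inclusion `ℂ ^ k → ℂ ^ l` (for `k ≤ l`) in coordinates: its matrix has the entry `1` on the
diagonal and `0` elsewhere. -/
noncomputable def coordIncl (k l : ℕ) : (Fin k → ℂ) →ₗ[ℂ] (Fin l → ℂ) :=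
  Matrix.toLin' (Matrix.of fun (r : Fin l) (c : Fin k) => if r.val = c.val then 1 else 0)

/-- The representation `M` of the grid quiver: `ℂ ^ i` at the vertices of row `i` (counted from
`1`), the standard inclusions at the arrows that go down, the identity at those that go right. -/
noncomputable def gridRep (n : ℕ) : CoordRep (GridVertex n) where
  dim a := a.row.val + 1
  map α := match α with
    | .down i _ => coordIncl (i.val + 1) (i.val + 1 + 1)
    | .right _ _ _ => LinearMap.id

/-- The representation satisfies the relations that make all squares of the grid commute. -/
theorem gridRep_comm (n : ℕ) (i j : Fin n) (hj : j.val + 1 < n) :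
    (gridRep n).map (GridArrow.down i ⟨j.val + 1, hj⟩) ∘ₗ
        (gridRep n).map (GridArrow.right i.castSucc j hj) =
      (gridRep n).map (GridArrow.right i.succ j hj) ∘ₗ (gridRep n).map (GridArrow.down i j) :=
  rfl

/-! ### Permutations, Schubert varieties and the dimension vector -/

/-- `w` avoids the pattern `π`: no subsequence of `w(1), w(2), …` has the same relative order as
the entries of `π`. -/
def AvoidsPattern {N k : ℕ} (w : Equiv.Perm (Fin N)) (π : Fin k → ℕ) : Prop :=
  ¬ ∃ g : Fin k ↪o Fin N, ∀ a b : Fin k, w (g a) < w (g b) ↔ π a < π b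

/-- `rankNum w p q` is the number of `k ≤ q` with `w k ≤ p`, everything being counted from `1`. -/
def rankNum {N : ℕ} (w : Equiv.Perm (Fin N)) (p q : ℕ) : ℕ :=
  (Finset.univ.filter fun k : Fin N => k.val + 1 ≤ q ∧ (w k).val + 1 ≤ p).card

/-- The entries of the dimension vector, for row `i` and column `j` counted from `1`; the value `0`
in row `0` and column `0` is never used in an essential way, since in row `1` and in column `1` the
first case always applies. -/
def dimEntry {N : ℕ} (w : Equiv.Perm (Fin N)) : ℕ → ℕ → ℕ
  | 0, _ => 0
  | _ + 1, 0 => 0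
  | i + 1, j + 1 =>
    if rankNum w (i + 1) (j + 1) = min (i + 1) (j + 1) ∨ rankNum w (i + 1) (j + 1) = 0 then
      rankNum w (i + 1) (j + 1)
    else max (dimEntry w i (j + 1)) (dimEntry w (i + 1) j)
  termination_by i j => i + j

/-- The dimension vector of the grid quiver that is attached to `w`. -/
def dimVector {n : ℕ} (w : Equiv.Perm (Fin (n + 1))) (a : GridVertex n) : ℕ :=
  dimEntry w (a.row.val + 1) (a.col.val + 1)

/-- The member `F_p` of the standard flag of `ℂ ^ N`: the span of the first `p` basis vectors. -/
def standardFlag (N p : ℕ) : Submodule ℂ (Fin N → ℂ) :=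
  Submodule.span ℂ {x | ∃ k : Fin N, k.val + 1 ≤ p ∧ x = Pi.single k 1}

/-- The variety of complete flags `V_1 ⊆ ⋯ ⊆ V_n` in `ℂ ^ (n + 1)`, with `dim V_q = q`, inside
`∏ q, Gr (q, ℂ ^ (n + 1))`. The index `q : Fin n` stands for `q + 1`. -/
def flagVariety (n : ℕ) :
    Set (MultiGrassmannian (fun _ : Fin n => n + 1) (fun q : Fin n => q.val + 1)) :=
  {V | ∀ q q' : Fin n, q ≤ q' → V.space q ≤ V.space q'}

/-- The Schubert variety of `w`: the flags with `dim (F_p ∩ V_q) ≥ #{k ≤ q : w k ≤ p}` for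
`1 ≤ p ≤ n + 1` and `1 ≤ q ≤ n`. (For `q = n + 1`, where `V_q` is the whole space, both sides
are equal to `p`.) -/
def schubertVariety {n : ℕ} (w : Equiv.Perm (Fin (n + 1))) :
    Set (MultiGrassmannian (fun _ : Fin n => n + 1) (fun q : Fin n => q.val + 1)) :=
  {V | V ∈ flagVariety n ∧ ∀ (p : Fin (n + 1)) (q : Fin n),
    rankNum w (p.val + 1) (q.val + 1) ≤
      Module.finrank ℂ ↥(standardFlag (n + 1) (p.val + 1) ⊓ V.space q)}

namespace MultiGrassmannian

variable {ι ι' : Type} {m d : ι → ℕ} {m' d' : ι' → ℕ}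

/-! ### Frames and Plücker coordinates -/

/-! Write r for the rank function of w. On X_w an equality r(p,j) = p forces F_p ⊆ V_j, and r(i,q) =
q forces V_q ⊆ F_i. Let p = `flagBound` and q = `spaceBound` be the largest p ≤ i and q ≤ j with
such an equality. Unrolling the recursion gives e(i,j) = max(p,q) (`dimEntry_eq`).

From a flag to a subrepresentation: put N(i,j) = F_p + V_q, which lies in F_i and grows with i and
j. Avoiding 3412 makes F_p and V_q comparable (`rankNum_bounds`), so the sum is the larger of the
two and has dimension e(i,j).

From a subrepresentation to a flag: at (p,j) with r(p,j) = p the space N(p,j) has dimension p inside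
ℂ^p, so it is F_p; at (i,q) with r(i,q) = q it has dimension q inside V_q = N(n+1,q), so it is V_q.
The arrows carry both into N(i,j), and equality of dimensions shows that the last row determines N
(`vertexSpace_lastRow`). That the last row lies in X_w is visible only where r = min(p,q), that is,
where the rank condition is an inclusion; avoiding 4231 and 3412 makes these conditions imply all
others (`rankNum_eq_min_of_essential`, `rankNum_le_of_forall_eq_min`).

Both maps are regular because every component is constant or a coordinate restriction of a component
of the source, so each Plücker coordinate pulls back to a constant or to a Plücker coordinate
(`HasPolynomialLift.of_components`). -/

theorem exists_isFrame (N : MultiGrassmannian m d) : ∃ A, N.IsFrame A := by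
  refine ⟨fun v r k => (Module.finBasisOfFinrankEq ℂ (N.space v) (N.finrank_space v) k :
    Fin (m v) → ℂ) r, fun v => ?_⟩
  set b := Module.finBasisOfFinrankEq ℂ (N.space v) (N.finrank_space v)
  have h : (Set.range fun k : Fin (d v) => fun r => (b k : Fin (m v) → ℂ) r) =
      (N.space v).subtype '' Set.range b := by
    rw [← Set.range_comp]; rfl
  rw [h, Submodule.span_image, b.span_eq, Submodule.map_top, Submodule.range_subtype]

theorem IsFrame.mulVec_injective {N : MultiGrassmannian m d}
    {A : ∀ v, Matrix (Fin (m v)) (Fin (d v)) ℂ} (hA : N.IsFrame A) (v : ι) :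
    Function.Injective (A v).mulVec := by
  rw [Matrix.mulVec_injective_iff]
  rw [linearIndependent_iff_card_eq_finrank_span, Set.finrank, Fintype.card_fin]
  have h := hA v
  exact (N.finrank_space v).symm.trans (by rw [← h]; rfl)

theorem IsFrame.exists_mul_eq {N : MultiGrassmannian m d}
    {A B : ∀ v, Matrix (Fin (m v)) (Fin (d v)) ℂ} (hA : N.IsFrame A) (hB : N.IsFrame B) (v : ι) :
    ∃ C : Matrix (Fin (d v)) (Fin (d v)) ℂ, B v = A v * C := by
  have h : ∀ k : Fin (d v), ∃ c : Fin (d v) → ℂ, ∑ i, c i • (fun r => A v r i) =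
      fun r => B v r k := fun k => by
    rw [← Submodule.mem_span_range_iff_exists_fun, hA v, ← hB v]
    exact Submodule.subset_span ⟨k, rfl⟩
  choose c hc using h
  refine ⟨Matrix.of fun i k => c k i, ?_⟩
  ext r k
  have := congrFun (hc k) r
  simp only [Finset.sum_apply, Pi.smul_apply, smul_eq_mul] at this
  rw [← this, Matrix.mul_apply]
  exact Finset.sum_congr rfl fun i _ => mul_comm _ _

/-- Two frames of the same point differ by an invertible matrix in each factor, and its determinant
rescales all minors of that factor. -/
theorem IsFrame.exists_plucker_eq_mul {N : MultiGrassmannian m d}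
    {A B : ∀ v, Matrix (Fin (m v)) (Fin (d v)) ℂ} (hA : N.IsFrame A) (hB : N.IsFrame B) :
    ∃ c : ι → ℂ, (∀ v, c v ≠ 0) ∧ ∀ x, plucker B x = c x.1 * plucker A x := by
  choose C hC using fun v => hA.exists_mul_eq hB v
  refine ⟨fun v => (C v).det, fun v => ?_, fun x => ?_⟩
  · have h : IsUnit (C v) := by
      rw [← Matrix.mulVec_injective_iff_isUnit]
      have h := hB.mulVec_injective v
      intro x y hxy
      apply h
      change (C v).mulVec x = (C v).mulVec y at hxy
      rw [hC v, ← Matrix.mulVec_mulVec, hxy, Matrix.mulVec_mulVec]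
    exact ((Matrix.isUnit_iff_isUnit_det _).1 h).ne_zero
  · simp only [plucker]
    rw [hC, mul_comm, ← Matrix.det_mul]
    rfl

/-! ### Multihomogeneous polynomials -/

/-- Any additive quantity attached to the factors has the same total on all monomials of a given
multidegree. Used additively for degrees under substitution, and through `Additive` for the scalar
produced by rescaling. -/
theorem sum_smul_eq_of_weight_eq {x : PluckerIndex m d →₀ ℕ} {k : ι →₀ ℕ} {M : Type*}
    [AddCommMonoid M] (K : ι → M)
    (h : Finsupp.weight (fun x : PluckerIndex m d => Finsupp.single x.1 1) x = k) :
    ∑ i ∈ x.support, x i • K i.1 = k.sum fun v n => n • K v := by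
  rw [← h, Finsupp.weight_apply, Finsupp.sum_sum_index (by simp) (by simp [add_smul])]
  refine Finset.sum_congr rfl fun i _ => ?_
  simp

theorem IsMultihomogeneous.eval_mul {p : MvPolynomial (PluckerIndex m d) ℂ} {k : ι →₀ ℕ}
    (hp : IsMultihomogeneous p k) (c : ι → ℂ) (u : PluckerIndex m d → ℂ) :
    MvPolynomial.eval (fun x => c x.1 * u x) p =
      (k.prod fun v n => c v ^ n) * MvPolynomial.eval u p := by
  rw [MvPolynomial.eval_eq, MvPolynomial.eval_eq, Finset.mul_sum]
  refine Finset.sum_congr rfl fun x hx => ?_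
  have h := hp (MvPolynomial.mem_support_iff.1 hx)
  have h2 : ∏ i ∈ x.support, c i.1 ^ x i = k.prod fun v n => c v ^ n := by
    have := sum_smul_eq_of_weight_eq (fun v => Additive.ofMul (c v)) h
    exact congrArg Additive.toMul this
  simp only [mul_pow, Finset.prod_mul_distrib]
  rw [h2]; ring

theorem IsMultihomogeneous.bind₁ {p : MvPolynomial (PluckerIndex m' d') ℂ} {k : ι' →₀ ℕ}
    (hp : IsMultihomogeneous p k) {K : ι' → ι →₀ ℕ}
    {T : PluckerIndex m' d' → MvPolynomial (PluckerIndex m d) ℂ}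
    (hT : ∀ x, IsMultihomogeneous (T x) (K x.1)) :
    IsMultihomogeneous (MvPolynomial.bind₁ T p) (k.sum fun v n => n • K v) := by
  rw [MvPolynomial.bind₁, MvPolynomial.aeval_def, MvPolynomial.eval₂_eq]
  refine MvPolynomial.IsWeightedHomogeneous.sum _ _ _ fun x hx => ?_
  rw [← sum_smul_eq_of_weight_eq K (hp (MvPolynomial.mem_support_iff.1 hx)),
    ← zero_add (∑ i ∈ x.support, _)]
  refine (MvPolynomial.isWeightedHomogeneous_C _ _).mul ?_
  exact MvPolynomial.IsWeightedHomogeneous.prod _ _ _ fun i _ => (hT i).pow _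

/-! ### Maps given by multihomogeneous polynomials -/

/-- `φ` is given by multihomogeneous polynomials in the Plücker coordinates. -/
def HasPolynomialLift {X : Set (MultiGrassmannian m d)} {Y : Set (MultiGrassmannian m' d')}
    (φ : X → Y) : Prop :=
  ∃ (K : ι' → ι →₀ ℕ) (T : PluckerIndex m' d' → MvPolynomial (PluckerIndex m d) ℂ),
    (∀ x, IsMultihomogeneous (T x) (K x.1)) ∧
      ∀ (N : X) A, N.1.IsFrame A → ∃ A', (φ N).1.IsFrame A' ∧
        ∀ x, plucker A' x = MvPolynomial.eval (plucker A) (T x)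

theorem eval_bind₁_eq {T : PluckerIndex m' d' → MvPolynomial (PluckerIndex m d) ℂ}
    {u : PluckerIndex m d → ℂ} {u' : PluckerIndex m' d' → ℂ}
    (h : ∀ x, u' x = MvPolynomial.eval u (T x)) (p : MvPolynomial (PluckerIndex m' d') ℂ) :
    MvPolynomial.eval u (MvPolynomial.bind₁ T p) = MvPolynomial.eval u' p := by
  obtain rfl : u' = fun x => MvPolynomial.eval u (T x) := funext h
  exact MvPolynomial.eval₂Hom_bind₁ _ _ _ _

namespace HasPolynomialLift

variable {X : Set (MultiGrassmannian m d)} {Y : Set (MultiGrassmannian m' d')} {φ : X → Y}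

theorem continuous (h : HasPolynomialLift φ) : Continuous φ := by
  obtain ⟨K, T, hT, hφ⟩ := h
  rw [continuous_induced_rng, continuous_generateFrom_iff]
  rintro _ ⟨p, k, hp, rfl⟩
  refine isOpen_induced_iff.2 ⟨nonvanishing (MvPolynomial.bind₁ T p),
    TopologicalSpace.isOpen_generateFrom_of_mem ⟨_, _, hp.bind₁ hT, rfl⟩, ?_⟩
  ext N
  constructor
  -- The lift controls only one frame of the image point; any other frame changes the value of `p`
  -- by a nonzero factor.
  · intro hN B hB
    obtain ⟨A, hA⟩ := exists_isFrame N.1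
    obtain ⟨A', hA', hu⟩ := hφ N A hA
    have h1 := hN A hA
    rw [eval_bind₁_eq hu] at h1
    obtain ⟨c, hc, hcu⟩ := hA'.exists_plucker_eq_mul hB
    rw [funext hcu, hp.eval_mul]
    exact mul_ne_zero (Finset.prod_ne_zero_iff.2 fun v _ => pow_ne_zero _ (hc v)) h1
  · intro hN A hA
    obtain ⟨A', hA', hu⟩ := hφ N A hA
    rw [eval_bind₁_eq hu]
    exact hN A' hA'

theorem isRegularOn_comp (h : HasPolynomialLift φ) {f : Y → ℂ} {U : Set Y}
    (hf : IsRegularOn f U) : IsRegularOn (f ∘ φ) (φ ⁻¹' U) := by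
  intro N hN
  obtain ⟨O, hO, hNO, hOU, k, p, q, hp, hq, hpq⟩ := hf (φ N) hN
  have hc := h.continuous
  obtain ⟨K, T, hT, hφ⟩ := h
  refine ⟨φ ⁻¹' O, hO.preimage hc, hNO, Set.preimage_mono hOU, _, _, _, hp.bind₁ hT, hq.bind₁ hT,
    fun N' hN' A hA => ?_⟩
  obtain ⟨A', hA', hu⟩ := hφ N' A hA
  rw [eval_bind₁_eq hu, eval_bind₁_eq hu]
  exact hpq _ hN' A' hA'

/-- A map each of whose components is either constant or the restriction of a component of the
source to some of the coordinates. -/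
theorem of_components
    (h : ∀ v' : ι', (∃ (v : ι) (ρ : Fin (m' v') ↪o Fin (m v)), d' v' = d v ∧
        ∀ N : X, (φ N).1.space v' = (N.1.space v).map (LinearMap.funLeft ℂ ℂ ρ)) ∨
      ∃ S, ∀ N : X, (φ N).1.space v' = S) : HasPolynomialLift φ := by
  have key : ∀ v' : ι', ∃ (K : ι →₀ ℕ)
      (T : (Fin (d' v') ↪o Fin (m' v')) → MvPolynomial (PluckerIndex m d) ℂ),
      (∀ σ, IsMultihomogeneous (T σ) K) ∧ ∀ (N : X) A, N.1.IsFrame A →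
        ∃ B : Matrix (Fin (m' v')) (Fin (d' v')) ℂ,
          Submodule.span ℂ (Set.range fun k => fun r => B r k) = (φ N).1.space v' ∧
          ∀ σ : Fin (d' v') ↪o Fin (m' v'),
            (B.submatrix σ id).det = MvPolynomial.eval (plucker A) (T σ) := by
    intro v'
    rcases h v' with ⟨v, ρ, hd, hv⟩ | ⟨S, hS⟩
    -- Since `ρ` is increasing, a minor of the restricted matrix is the minor of the original one on
    -- the rows `ρ ∘ σ`: a single Plücker coordinate.
    · refine ⟨Finsupp.single v 1,
        fun σ => MvPolynomial.X ⟨v, ((Fin.castOrderIso hd.symm).toOrderEmbedding.trans σ).trans ρ⟩,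
        fun σ => MvPolynomial.isWeightedHomogeneous_X ℂ _ _, fun N A hA =>
          ⟨(A v).submatrix ρ (Fin.cast hd), ?_, fun σ => ?_⟩⟩
      · rw [hv N, ← hA v, Submodule.map_span, ← Set.range_comp]
        congr 1
        ext y
        constructor
        · rintro ⟨k, rfl⟩
          exact ⟨Fin.cast hd k, rfl⟩
        · rintro ⟨k, rfl⟩
          exact ⟨Fin.cast hd.symm k, rfl⟩
      · rw [MvPolynomial.eval_X, plucker,
          ← Matrix.det_submatrix_equiv_self (finCongr hd)]
        rfl
    -- A frame of `S` is taken from the image of some point. If `X` is empty, nothing forces `S` to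
    -- have the right dimension, and any polynomial serves.
    · by_cases hX : Nonempty X
      · obtain ⟨N₀⟩ := hX
        obtain ⟨B, hB⟩ := exists_isFrame (φ N₀).1
        refine ⟨0, fun σ => MvPolynomial.C ((B v').submatrix σ id).det,
          fun σ => MvPolynomial.isWeightedHomogeneous_C _ _, fun N A _ => ⟨B v', ?_, fun σ => ?_⟩⟩
        · rw [hB v', hS, hS]
        · rw [MvPolynomial.eval_C]
      · exact ⟨0, fun σ => 0, fun σ => MvPolynomial.isWeightedHomogeneous_zero _ _ _,
          fun N => absurd ⟨N⟩ hX⟩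
  choose K T hT hφ using key
  refine ⟨K, fun x => T x.1 x.2, fun x => hT x.1 x.2, fun N A hA => ?_⟩
  choose B hB hB' using fun v' => hφ v' N A hA
  exact ⟨B, hB, fun x => hB' x.1 x.2⟩

end HasPolynomialLift

end MultiGrassmannian

/-- Mutually inverse maps given by multihomogeneous polynomials form an isomorphism. -/
def VarietyIso.ofPolynomialLift {ι ι' : Type} {m d : ι → ℕ} {m' d' : ι' → ℕ}
    {X : Set (MultiGrassmannian m d)} {Y : Set (MultiGrassmannian m' d')} (e : X ≃ Y)
    (h : MultiGrassmannian.HasPolynomialLift e) (h' : MultiGrassmannian.HasPolynomialLift e.symm) :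
    VarietyIso X Y where
  toHomeomorph := ⟨e, h.continuous, h'.continuous⟩
  regular_iff U _ f := by
    refine ⟨fun hf => h.isRegularOn_comp hf, fun hf => ?_⟩
    have := h'.isRegularOn_comp hf
    convert this
    · ext y; exact congrArg f (e.apply_symm_apply y).symm
    · ext y
      change y ∈ U ↔ e (e.symm y) ∈ U
      rw [e.apply_symm_apply]

/-! ### Rank numbers -/

section RankNum

variable {N : ℕ} (w : Equiv.Perm (Fin N))

theorem rankNum_mono {p p' q q' : ℕ} (hp : p ≤ p') (hq : q ≤ q') :
    rankNum w p q ≤ rankNum w p' q' :=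
  Finset.card_le_card fun k hk => by
    simp only [Finset.mem_filter, Finset.mem_univ, true_and] at hk ⊢
    omega

theorem card_filter_val_lt (q : ℕ) :
    (Finset.univ.filter fun k : Fin N => k.val + 1 ≤ q).card = min q N := by
  have := Fin.card_filter_val_lt (n := N) (m := q)
  simp only [Nat.succ_le_iff]
  rw [this, min_comm]

theorem card_filter_apply_lt (p : ℕ) :
    (Finset.univ.filter fun k : Fin N => (w k).val + 1 ≤ p).card = min p N := by
  rw [← card_filter_val_lt]
  refine Finset.card_bij (fun k _ => w k) (by simp) (by simp) fun k hk => ⟨w.symm k, by simpa using hk⟩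

theorem rankNum_le_right (p q : ℕ) : rankNum w p q ≤ q :=
  (Finset.card_le_card fun k hk => by
    simp only [Finset.mem_filter, Finset.mem_univ, true_and] at hk ⊢
    exact hk.1).trans ((card_filter_val_lt (N := N) q).trans_le (min_le_left _ _))

theorem rankNum_le_left (p q : ℕ) : rankNum w p q ≤ p :=
  (Finset.card_le_card fun k hk => by
    simp only [Finset.mem_filter, Finset.mem_univ, true_and] at hk ⊢
    exact hk.2).trans ((card_filter_apply_lt w p).trans_le (min_le_left _ _))

theorem rankNum_zero_left (q : ℕ) : rankNum w 0 q = 0 :=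
  Nat.le_zero.1 (rankNum_le_left w 0 q)

theorem rankNum_zero_right (p : ℕ) : rankNum w p 0 = 0 :=
  Nat.le_zero.1 (rankNum_le_right w p 0)

theorem rankNum_eq_right_iff {p q : ℕ} (hq : q ≤ N) :
    rankNum w p q = q ↔ ∀ k : Fin N, k.val + 1 ≤ q → (w k).val + 1 ≤ p := by
  have h := card_filter_val_lt (N := N) q
  rw [min_eq_left hq] at h
  constructor
  · intro hr k hk
    have := Finset.eq_of_subset_of_card_le (s := Finset.univ.filter fun k : Fin N =>
      k.val + 1 ≤ q ∧ (w k).val + 1 ≤ p) (t := Finset.univ.filter fun k : Fin N => k.val + 1 ≤ q)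
      (fun k => by simp +contextual) (by rw [h]; exact hr.ge)
    have hk' : k ∈ Finset.univ.filter fun k : Fin N => k.val + 1 ≤ q := by simpa using hk
    rw [← this] at hk'
    simp only [Finset.mem_filter, Finset.mem_univ, true_and] at hk'
    exact hk'.2
  · intro hk
    rw [rankNum, Finset.filter_congr (q := fun k : Fin N => k.val + 1 ≤ q), h]
    exact fun k _ => ⟨fun h => h.1, fun h => ⟨h, hk k h⟩⟩

theorem rankNum_eq_left_iff {p q : ℕ} (hp : p ≤ N) :
    rankNum w p q = p ↔ ∀ k : Fin N, (w k).val + 1 ≤ p → k.val + 1 ≤ q := by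
  have h := card_filter_apply_lt w p
  rw [min_eq_left hp] at h
  constructor
  · intro hr k hk
    have := Finset.eq_of_subset_of_card_le (s := Finset.univ.filter fun k : Fin N =>
      k.val + 1 ≤ q ∧ (w k).val + 1 ≤ p)
      (t := Finset.univ.filter fun k : Fin N => (w k).val + 1 ≤ p)
      (fun k => by simp +contextual) (by rw [h]; exact hr.ge)
    have hk' : k ∈ Finset.univ.filter fun k : Fin N => (w k).val + 1 ≤ p := by simpa using hk
    rw [← this] at hk'
    simp only [Finset.mem_filter, Finset.mem_univ, true_and] at hk'
    exact hk'.1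
  · intro hk
    rw [rankNum, Finset.filter_congr (q := fun k : Fin N => (w k).val + 1 ≤ p), h]
    exact fun k _ => ⟨fun h => h.2, fun h => ⟨hk k h, h⟩⟩

theorem rankNum_top_left {q : ℕ} (hq : q ≤ N) : rankNum w N q = q :=
  (rankNum_eq_right_iff w hq).2 fun k _ => (w k).isLt

theorem rankNum_top_right {p : ℕ} (hp : p ≤ N) : rankNum w p N = p :=
  (rankNum_eq_left_iff w hp).2 fun k _ => k.isLt

theorem rankNum_succ_right (p : ℕ) (k : Fin N) :
    rankNum w p (k.val + 1) = rankNum w p k.val + if (w k).val + 1 ≤ p then 1 else 0 := by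
  have h : (Finset.univ.filter fun l : Fin N => l.val + 1 ≤ k.val + 1 ∧ (w l).val + 1 ≤ p) =
      (Finset.univ.filter fun l : Fin N => l.val + 1 ≤ k.val ∧ (w l).val + 1 ≤ p) ∪
        if (w k).val + 1 ≤ p then {k} else ∅ := by
    ext l
    split_ifs with hk <;> simp [Fin.ext_iff]
    · by_cases hl : l = k
      · subst hl; omega
      · have := Fin.val_ne_of_ne hl; omega
    · by_cases hl : l = k
      · subst hl; omega
      · have := Fin.val_ne_of_ne hl; omega
  rw [rankNum, h, Finset.card_union_of_disjoint, rankNum]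
  · split_ifs <;> simp
  · split_ifs <;> simp

theorem rankNum_symm (p q : ℕ) : rankNum w.symm q p = rankNum w p q := by
  refine Finset.card_bij (fun k _ => w.symm k) ?_ (by simp) ?_
  · intro k hk
    simp at hk ⊢
    omega
  · intro k hk
    exact ⟨w k, by simp at hk ⊢; omega, by simp⟩

theorem rankNum_succ_left (k : Fin N) (q : ℕ) :
    rankNum w ((w k).val + 1) q = rankNum w (w k).val q + if k.val + 1 ≤ q then 1 else 0 := by
  have := rankNum_succ_right w.symm q (w k)
  rwa [rankNum_symm, rankNum_symm, Equiv.symm_apply_apply] at this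

/-! ### The dimension vector -/

/-- The largest `p ≤ i` such that the values `1, …, p` are taken at the first `j` positions. -/
def flagBound (i j : ℕ) : ℕ := Nat.findGreatest (fun p => rankNum w p j = p) i

/-- The largest `q ≤ j` such that the first `q` values are at most `i`. -/
def spaceBound (i j : ℕ) : ℕ := Nat.findGreatest (fun q => rankNum w i q = q) j

theorem flagBound_le (i j : ℕ) : flagBound w i j ≤ i := Nat.findGreatest_le _

theorem spaceBound_le (i j : ℕ) : spaceBound w i j ≤ j := Nat.findGreatest_le _

theorem rankNum_flagBound (i j : ℕ) : rankNum w (flagBound w i j) j = flagBound w i j :=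
  Nat.findGreatest_spec (P := fun p => rankNum w p j = p) (Nat.zero_le i) (rankNum_zero_left w j)

theorem rankNum_spaceBound (i j : ℕ) : rankNum w i (spaceBound w i j) = spaceBound w i j :=
  Nat.findGreatest_spec (P := fun q => rankNum w i q = q) (Nat.zero_le j) (rankNum_zero_right w i)

theorem le_flagBound {i j p : ℕ} (hp : p ≤ i) (h : rankNum w p j = p) : p ≤ flagBound w i j :=
  Nat.le_findGreatest hp h

theorem le_spaceBound {i j q : ℕ} (hq : q ≤ j) (h : rankNum w i q = q) : q ≤ spaceBound w i j :=
  Nat.le_findGreatest hq h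

theorem flagBound_mono {i i' j j' : ℕ} (hi : i ≤ i') (hj : j ≤ j') :
    flagBound w i j ≤ flagBound w i' j' := by
  refine le_flagBound w ((flagBound_le w i j).trans hi) (le_antisymm (rankNum_le_left _ _ _) ?_)
  exact (rankNum_flagBound w i j).ge.trans (rankNum_mono w le_rfl hj)

theorem spaceBound_mono {i i' j j' : ℕ} (hi : i ≤ i') (hj : j ≤ j') :
    spaceBound w i j ≤ spaceBound w i' j' := by
  refine le_spaceBound w ((spaceBound_le w i j).trans hj) (le_antisymm (rankNum_le_right _ _ _) ?_)
  exact (rankNum_spaceBound w i j).ge.trans (rankNum_mono w hi le_rfl)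

theorem flagBound_le_rankNum (i j : ℕ) : flagBound w i j ≤ rankNum w i j :=
  (rankNum_flagBound w i j).ge.trans (rankNum_mono w (flagBound_le w i j) le_rfl)

theorem spaceBound_le_rankNum (i j : ℕ) : spaceBound w i j ≤ rankNum w i j :=
  (rankNum_spaceBound w i j).ge.trans (rankNum_mono w le_rfl (spaceBound_le w i j))

/-- Both bounds are at most the rank. If the rank is i or j, then i or j is itself admissible in the
corresponding maximum. -/
theorem max_bounds_eq_rankNum {i j : ℕ} (h : rankNum w i j = min i j ∨ rankNum w i j = 0) :
    max (flagBound w i j) (spaceBound w i j) = rankNum w i j := by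
  have h1 := flagBound_le_rankNum w i j
  have h2 := spaceBound_le_rankNum w i j
  refine le_antisymm (max_le h1 h2) ?_
  rcases h with h | h
  · rcases le_total i j with hij | hij
    · rw [min_eq_left hij] at h
      rw [h]
      exact (le_flagBound w le_rfl h).trans (le_max_left _ _)
    · rw [min_eq_right hij] at h
      rw [h]
      exact (le_spaceBound w le_rfl h).trans (le_max_right _ _)
  · rw [h]; exact Nat.zero_le _

theorem flagBound_succ_left {i j : ℕ} (h : rankNum w (i + 1) j ≠ i + 1) :
    flagBound w (i + 1) j = flagBound w i j := by
  exact Nat.findGreatest_of_not (P := fun p => rankNum w p j = p) h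

theorem spaceBound_succ_right {i j : ℕ} (h : rankNum w i (j + 1) ≠ j + 1) :
    spaceBound w i (j + 1) = spaceBound w i j := by
  exact Nat.findGreatest_of_not (P := fun q => rankNum w i q = q) h

theorem dimEntry_eq (i j : ℕ) : dimEntry w i j = max (flagBound w i j) (spaceBound w i j) := by
  induction h : i + j using Nat.strong_induction_on generalizing i j with
  | _ s ih =>
    match i, j with
    | 0, j =>
      have h1 := flagBound_le_rankNum w 0 j
      have h2 := spaceBound_le_rankNum w 0 j
      rw [rankNum_zero_left] at h1 h2
      rw [dimEntry]; omega
    | i + 1, 0 =>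
      have h1 := flagBound_le_rankNum w (i + 1) 0
      have h2 := spaceBound_le_rankNum w (i + 1) 0
      rw [rankNum_zero_right] at h1 h2
      rw [dimEntry]; omega
    | i + 1, j + 1 =>
      rw [dimEntry]
      split_ifs with hr
      · exact (max_bounds_eq_rankNum w hr).symm
      -- Here the rank is below both indices, so the new index is admissible for neither bound: the
      -- first bound is inherited from above, the second from the left, and the remaining two terms
      -- are smaller by monotonicity.
      · rw [ih _ (by omega) i (j + 1) rfl, ih _ (by omega) (i + 1) j rfl]
        have h1 := rankNum_le_left w (i + 1) (j + 1)
        have h2 := rankNum_le_right w (i + 1) (j + 1)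
        have h3 := flagBound_succ_left w (i := i) (j := j + 1) (by omega)
        have h4 := spaceBound_succ_right w (i := i + 1) (j := j) (by omega)
        have h5 := flagBound_mono w (le_refl (i + 1)) (Nat.le_succ j)
        have h6 := spaceBound_mono w (Nat.le_succ i) (le_refl (j + 1))
        simp only [Nat.succ_eq_add_one] at h5 h6
        omega

/-! ### Pattern avoidance -/

variable {w}

theorem AvoidsPattern.not_4231 (h : AvoidsPattern w ![4, 2, 3, 1]) {a b c d : Fin N}
    (hab : a < b) (hbc : b < c) (hcd : c < d) (h1 : w d < w b) (h2 : w b < w c) (h3 : w c < w a) :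
    False := by
  have hm : StrictMono ![a, b, c, d] := by
    rw [Fin.strictMono_iff_lt_succ]
    intro i; fin_cases i
    exacts [hab, hbc, hcd]
  refine h ⟨OrderEmbedding.ofStrictMono _ hm, fun i j => ?_⟩
  have := h1.trans h2
  have := h2.trans h3
  have := this.trans' h1
  fin_cases i <;> fin_cases j <;> simp [*, not_lt_of_gt]

theorem AvoidsPattern.not_3412 (h : AvoidsPattern w ![3, 4, 1, 2]) {a b c d : Fin N}
    (hab : a < b) (hbc : b < c) (hcd : c < d) (h1 : w c < w d) (h2 : w d < w a) (h3 : w a < w b) :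
    False := by
  have hm : StrictMono ![a, b, c, d] := by
    rw [Fin.strictMono_iff_lt_succ]
    intro i; fin_cases i
    exacts [hab, hbc, hcd]
  refine h ⟨OrderEmbedding.ofStrictMono _ hm, fun i j => ?_⟩
  have := h1.trans h2
  have := h2.trans h3
  have := this.trans' h1
  fin_cases i <;> fin_cases j <;> simp [*, not_lt_of_gt]

theorem exists_le_lt_apply {p q : ℕ} (hq : q ≤ N) (h : rankNum w p q ≠ q) :
    ∃ k : Fin N, k.val + 1 ≤ q ∧ p < (w k).val + 1 := by
  rw [Ne, rankNum_eq_right_iff w hq] at h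
  push Not at h
  exact h

theorem exists_lt_apply_le {p q : ℕ} (hp : p ≤ N) (h : rankNum w p q ≠ p) :
    ∃ k : Fin N, q < k.val + 1 ∧ (w k).val + 1 ≤ p := by
  rw [Ne, rankNum_eq_left_iff w hp] at h
  push Not at h
  obtain ⟨k, h1, h2⟩ := h
  exact ⟨k, h2, h1⟩

/-- This says that F_p and V_q are comparable. Otherwise some k ≤ q has w(k) > p and some l > q has
w(l) ≤ p. By maximality of p the value p+1 occurs at a position l' > j, and by maximality of q the
value at position q+1 exceeds i. Then k, q+1, l, l' form a 3412. -/
theorem rankNum_bounds (h3412 : AvoidsPattern w ![3, 4, 1, 2]) {i j : ℕ} (hi : i ≤ N)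
    (hj : j ≤ N) :
    rankNum w (flagBound w i j) (spaceBound w i j) = min (flagBound w i j) (spaceBound w i j) := by
  have hpi := flagBound_le w i j
  have hqj := spaceBound_le w i j
  have hrp := rankNum_flagBound w i j
  have hrq := rankNum_spaceBound w i j
  have hmaxp : ∀ p ≤ i, rankNum w p j = p → p ≤ flagBound w i j := fun p => le_flagBound w
  have hmaxq : ∀ q ≤ j, rankNum w i q = q → q ≤ spaceBound w i j := fun q => le_spaceBound w
  generalize flagBound w i j = p at *
  generalize spaceBound w i j = q at *
  have hl := rankNum_le_left w p q
  have hr := rankNum_le_right w p q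
  by_contra hne
  obtain ⟨k, hk, hwk⟩ := exists_le_lt_apply (w := w) (p := p) (hqj.trans hj) (by omega)
  obtain ⟨l, hl, hwl⟩ := exists_lt_apply_le (w := w) (q := q) (hpi.trans hi) (by omega)
  have hlj := (rankNum_eq_left_iff w (hpi.trans hi)).1 hrp l hwl
  have hki := (rankNum_eq_right_iff w (hqj.trans hj)).1 hrq k hk
  have hw : ∀ a : Fin N, ∃ b, w b = a := fun a => ⟨w.symm a, by simp⟩
  -- Counted from 0, the entry `p` is the value p+1, and below `⟨q, _⟩` is the position q+1.
  obtain ⟨l', hl'⟩ := hw ⟨p, by omega⟩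
  have hl'v : (w l').val = p := by rw [hl']
  have hjl' : j < l'.val + 1 := by
    by_contra hcon
    have := hmaxp (p + 1) (by omega) (by
      have := rankNum_succ_left w l' j
      rw [hl'v, hrp, if_pos (by omega)] at this
      exact this)
    omega
  have hk' : i < (w ⟨q, by omega⟩).val + 1 := by
    by_contra hcon
    have := hmaxq (q + 1) (by omega) (by
      have := rankNum_succ_right w i ⟨q, by omega⟩
      rw [if_pos (by omega)] at this
      simpa [hrq] using this)
    omega
  have hne1 : l ≠ ⟨q, by omega⟩ := fun h => by rw [h] at hwl; omega
  have hne1' := Fin.val_ne_of_ne hne1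
  have hne2 : (w k).val ≠ (w l').val := fun h => by
    have := w.injective (Fin.ext h); omega
  exact h3412.not_3412 (a := k) (b := ⟨q, by omega⟩) (c := l) (d := l')
    (Fin.lt_def.2 (by simp only; omega)) (Fin.lt_def.2 (by simp only at *; omega))
    (Fin.lt_def.2 (by omega)) (Fin.lt_def.2 (by omega)) (Fin.lt_def.2 (by omega))
    (Fin.lt_def.2 (by omega))

/-- At the essential positions of a permutation that avoids `4231` and `3412` the rank is
maximal. -/
theorem rankNum_eq_min_of_essential (h4231 : AvoidsPattern w ![4, 2, 3, 1])
    (h3412 : AvoidsPattern w ![3, 4, 1, 2]) {a b c c' : Fin N} {p q : ℕ} (hp : p ≤ N) (hq : q ≤ N)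
    (hc : c.val + 1 = q) (hc' : c'.val = q) (ha : (w a).val + 1 = p) (hb : (w b).val = p)
    (hwc : (w c).val + 1 ≤ p) (hwc' : p < (w c').val + 1) (haq : a.val + 1 ≤ q)
    (hbq : q < b.val + 1) : rankNum w p q = min p q := by
  have hl := rankNum_le_left w p q
  have hr := rankNum_le_right w p q
  by_contra hne
  -- A rank that is not maximal yields a large value at an early position k and a small value at a
  -- late position l. With a, b (values p, p+1) and c, c' (positions q, q+1) they always contain a
  -- forbidden pattern; a = c and b = c' are allowed.
  obtain ⟨k, hk, hwk⟩ := exists_le_lt_apply (w := w) (p := p) hq (by omega)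
  obtain ⟨l, hl, hwl⟩ := exists_lt_apply_le (w := w) (q := q) hp (by omega)
  have inj : ∀ {x y : Fin N}, (w x).val = (w y).val → x.val = y.val := fun h =>
    congrArg Fin.val (w.injective (Fin.ext h))
  have inj' : ∀ {x y : Fin N}, x.val = y.val → (w x).val = (w y).val := fun h => by
    rw [Fin.ext h]
  -- The coincidences to be excluded, so that the weak inequalities below become strict.
  have e1 := @inj k b
  have e2 := @inj l a
  have e3 := @inj' k c
  have e4 := @inj' l c'
  have e5 := @inj' k a
  have e6 := @inj' l b
  have e7 := @inj l c
  have e8 := @inj k c'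
  have P1 := @AvoidsPattern.not_4231 _ w h4231
  have P2 := @AvoidsPattern.not_3412 _ w h3412
  simp only [Fin.lt_def] at P1 P2
  rcases lt_or_ge k.val a.val with hka | hka
  · rcases lt_or_ge (w c').val (w k).val with h1 | h1
    · exact P1 (a := k) (b := a) (c := c') (d := l) (by omega) (by omega) (by omega) (by omega)
        (by omega) (by omega)
    rcases lt_or_ge b.val l.val with h2 | h2
    · exact P1 (a := k) (b := a) (c := b) (d := l) (by omega) (by omega) (by omega) (by omega)
        (by omega) (by omega)
    · exact P2 (a := k) (b := c') (c := l) (d := b) (by omega) (by omega) (by omega) (by omega)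
        (by omega) (by omega)
  · rcases lt_or_ge (w c).val (w l).val with h1 | h1
    · exact P2 (a := a) (b := k) (c := c) (d := l) (by omega) (by omega) (by omega) (by omega)
        (by omega) (by omega)
    rcases lt_or_ge b.val l.val with h2 | h2
    · exact P1 (a := k) (b := c) (c := b) (d := l) (by omega) (by omega) (by omega) (by omega)
        (by omega) (by omega)
    rcases lt_or_ge (w k).val (w c').val with h3 | h3
    · exact P2 (a := k) (b := c') (c := l) (d := b) (by omega) (by omega) (by omega) (by omega)
        (by omega) (by omega)
    · exact P1 (a := k) (b := c) (c := c') (d := l) (by omega) (by omega) (by omega) (by omega)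
        (by omega) (by omega)

end RankNum

/-- A function with the growth properties of `dim (F_p ∩ V_q)` that is at least the rank function of
a permutation avoiding `4231` and `3412` wherever the latter is maximal is so everywhere. -/
theorem rankNum_le_of_forall_eq_min {N : ℕ} {w : Equiv.Perm (Fin N)}
    (h4231 : AvoidsPattern w ![4, 2, 3, 1]) (h3412 : AvoidsPattern w ![3, 4, 1, 2])
    (D : ℕ → ℕ → ℕ) (hleft : ∀ p q, D p q ≤ D (p + 1) q) (hright : ∀ p q, D p q ≤ D p (q + 1))
    (hleft' : ∀ p q, D (p + 1) q ≤ D p q + 1)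
    (hright' : ∀ p q, q < N → D p (q + 1) ≤ D p q + 1)
    (hD : ∀ p q, p ≤ N → q ≤ N → rankNum w p q = min p q → rankNum w p q ≤ D p q)
    {p q : ℕ} (hp : p ≤ N) (hq : q ≤ N) : rankNum w p q ≤ D p q := by
  -- The measure counts the first q positions with value above p plus the values up to p at
  -- positions beyond q. Unless (p,q) is essential, some neighbour has smaller measure, and its
  -- inequality passes to (p,q) by the growth properties of `D`.
  induction h : p + q - 2 * rankNum w p q using Nat.strong_induction_on generalizing p q with
  | _ s ih =>
    by_cases hmin : rankNum w p q = min p q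
    · exact hD p q hp hq hmin
    have hl := rankNum_le_left w p q
    have hr := rankNum_le_right w p q
    rcases hp.eq_or_lt with rfl | hpN
    · rw [rankNum_top_left w hq] at hmin; omega
    rcases hq.eq_or_lt with rfl | hqN
    · rw [rankNum_top_right w hp] at hmin; omega
    obtain ⟨p', rfl⟩ : ∃ p', p = p' + 1 := ⟨p - 1, by omega⟩
    obtain ⟨q', rfl⟩ : ∃ q', q = q' + 1 := ⟨q - 1, by omega⟩
    have hw : ∀ a : Fin N, ∃ b, w b = a := fun a => ⟨w.symm a, by simp⟩
    obtain ⟨a, ha⟩ := hw ⟨p', by omega⟩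
    obtain ⟨b, hb⟩ := hw ⟨p' + 1, by omega⟩
    have ha' : (w a).val = p' := by rw [ha]
    have hb' : (w b).val = p' + 1 := by rw [hb]
    have hr1 := rankNum_succ_right w (p' + 1) ⟨q', by omega⟩
    have hr2 := rankNum_succ_right w (p' + 1) ⟨q' + 1, by omega⟩
    have hr3 := rankNum_succ_left w a (q' + 1)
    have hr4 := rankNum_succ_left w b (q' + 1)
    simp only [ha', hb'] at hr1 hr2 hr3 hr4
    have l1 := rankNum_le_left w (p' + 1) (q' + 1 + 1)
    have l2 := rankNum_le_right w (p' + 1 + 1) (q' + 1)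
    by_cases c1 : (w ⟨q', by omega⟩).val + 1 ≤ p' + 1
    swap
    · rw [if_neg c1] at hr1
      have := ih _ (by omega) (p := p' + 1) (q := q') (by omega) (by omega) rfl
      have := hright (p' + 1) q'
      omega
    by_cases c2 : (w ⟨q' + 1, by omega⟩).val + 1 ≤ p' + 1
    · rw [if_pos c2] at hr2
      have := ih _ (by omega) (p := p' + 1) (q := q' + 1 + 1) (by omega) (by omega) rfl
      have := hright' (p' + 1) (q' + 1) hqN
      omega
    by_cases c3 : a.val + 1 ≤ q' + 1
    swap
    · rw [if_neg c3] at hr3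
      have := ih _ (by omega) (p := p') (q := q' + 1) (by omega) (by omega) rfl
      have := hleft p' (q' + 1)
      omega
    by_cases c4 : b.val + 1 ≤ q' + 1
    · rw [if_pos c4] at hr4
      have := ih _ (by omega) (p := p' + 1 + 1) (q := q' + 1) (by omega) (by omega) rfl
      have := hleft' (p' + 1) (q' + 1)
      omega
    -- No neighbour helps, so (p,q) is essential and the rank would be maximal.
    exact absurd (rankNum_eq_min_of_essential h4231 h3412 hp hq (c := ⟨q', by omega⟩)
      (c' := ⟨q' + 1, by omega⟩) (a := a) (b := b) rfl rfl (by omega) hb' c1 (by omega) c3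
      (by omega)) hmin

/-! ### The standard flag and coordinate inclusions -/

theorem mem_standardFlag {N p : ℕ} {x : Fin N → ℂ} :
    x ∈ standardFlag N p ↔ ∀ k : Fin N, p ≤ k.val → x k = 0 := by
  constructor
  · intro hx k hk
    have h : standardFlag N p ≤ LinearMap.ker (LinearMap.proj k : (Fin N → ℂ) →ₗ[ℂ] ℂ) := by
      refine Submodule.span_le.2 ?_
      rintro _ ⟨l, hl, rfl⟩
      have : k ≠ l := by rintro rfl; omega
      simp [this]
    exact h hx
  · intro h
    rw [← Finset.univ_sum_single x]
    refine Submodule.sum_mem _ fun k _ => ?_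
    by_cases hk : p ≤ k.val
    · rw [h k hk, Pi.single_zero]; exact Submodule.zero_mem _
    · have : (Pi.single k (x k) : Fin N → ℂ) = x k • Pi.single k 1 := by
        rw [← Pi.single_smul, smul_eq_mul, mul_one]
      rw [this]
      exact Submodule.smul_mem _ _ (Submodule.subset_span ⟨k, by omega, rfl⟩)

theorem standardFlag_mono (N : ℕ) {p p' : ℕ} (h : p ≤ p') : standardFlag N p ≤ standardFlag N p' :=
  fun _ hx => mem_standardFlag.2 fun k hk => mem_standardFlag.1 hx k (h.trans hk)

theorem finrank_standardFlag (N p : ℕ) : Module.finrank ℂ (standardFlag N p) = min p N := by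
  have h : standardFlag N p = Submodule.span ℂ (Set.range fun k : Fin (min p N) =>
      Pi.basisFun ℂ (Fin N) (Fin.castLE (min_le_right _ _) k)) := by
    rw [standardFlag]
    congr 1
    ext x
    constructor
    · rintro ⟨k, hk, rfl⟩
      exact ⟨⟨k, by omega⟩, by simp⟩
    · rintro ⟨k, rfl⟩
      exact ⟨Fin.castLE (min_le_right _ _) k, by simp; omega, by simp⟩
  rw [h, finrank_span_eq_card, Fintype.card_fin]
  exact (Pi.basisFun ℂ (Fin N)).linearIndependent.comp _ (Fin.castLE_injective _)

/-- Apply the dimension formula to A and B ⊓ V: their sum lies in B and their intersection is A ⊓ V.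
-/
theorem Submodule.finrank_inf_le_add_one {K E : Type*} [Field K] [AddCommGroup E] [Module K E]
    [FiniteDimensional K E] {A B : Submodule K E} (hAB : A ≤ B)
    (h : Module.finrank K B ≤ Module.finrank K A + 1) (V : Submodule K E) :
    Module.finrank K ↥(B ⊓ V) ≤ Module.finrank K ↥(A ⊓ V) + 1 := by
  have h1 := Submodule.finrank_sup_add_finrank_inf_eq A (B ⊓ V)
  rw [← inf_assoc, inf_eq_left.2 hAB] at h1
  have h2 := Submodule.finrank_mono (sup_le hAB (inf_le_left : B ⊓ V ≤ B))
  omega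

theorem coordIncl_apply {k l : ℕ} (x : Fin k → ℂ) (r : Fin l) :
    coordIncl k l x r = if h : r.val < k then x ⟨r, h⟩ else 0 := by
  simp only [coordIncl, Matrix.toLin'_apply, Matrix.mulVec, dotProduct, Matrix.of_apply, ite_mul,
    one_mul, zero_mul]
  split_ifs with h
  · rw [Finset.sum_eq_single ⟨r, h⟩]
    · simp
    · intro c _ hc
      rw [if_neg]
      exact fun hrc => hc (Fin.ext hrc.symm)
    · simp
  · refine Finset.sum_eq_zero fun c _ => if_neg ?_
    omega

theorem coordIncl_self (k : ℕ) : coordIncl k k = LinearMap.id := by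
  refine LinearMap.ext fun x => funext fun r => ?_
  simp [coordIncl_apply]

theorem coordIncl_comp {k l m : ℕ} (h : k ≤ l) :
    coordIncl l m ∘ₗ coordIncl k l = coordIncl k m := by
  refine LinearMap.ext fun x => funext fun r => ?_
  simp only [LinearMap.comp_apply, coordIncl_apply]
  split_ifs with h1 h2 h2
  · rfl
  · rfl
  · omega
  · rfl

/-- The projection of `ℂ ^ l` to its first `k` coordinates. -/
noncomputable def truncate {k l : ℕ} (h : k ≤ l) : (Fin l → ℂ) →ₗ[ℂ] (Fin k → ℂ) :=
  LinearMap.funLeft ℂ ℂ (Fin.castLEOrderEmb h)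

theorem truncate_coordIncl {k l : ℕ} (h : k ≤ l) (x : Fin k → ℂ) :
    truncate h (coordIncl k l x) = x := by
  refine funext fun r => ?_
  simp [truncate, LinearMap.funLeft_apply, coordIncl_apply]

/-- Truncation loses nothing on F_k. With m = l this recovers the vector; with m = k + 1 it is
compatibility with the downward arrows. -/
theorem coordIncl_truncate {k l m : ℕ} (h : k ≤ l) (h' : m ≤ l) {x : Fin l → ℂ}
    (hx : x ∈ standardFlag l k) : coordIncl k m (truncate h x) = truncate h' x := by
  refine funext fun r => ?_
  simp only [truncate, LinearMap.funLeft_apply, coordIncl_apply]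
  split_ifs with h1
  · rfl
  · exact (mem_standardFlag.1 hx _ (by simpa using h1)).symm

theorem coordIncl_injective {k l : ℕ} (h : k ≤ l) : Function.Injective (coordIncl k l) :=
  Function.LeftInverse.injective (truncate_coordIncl h)

theorem coordIncl_mem_standardFlag {k l : ℕ} (x : Fin k → ℂ) :
    coordIncl k l x ∈ standardFlag l k :=
  mem_standardFlag.2 fun r hr => by rw [coordIncl_apply, dif_neg (by omega)]

theorem finrank_map_truncate {k l : ℕ} (h : k ≤ l) {S : Submodule ℂ (Fin l → ℂ)}
    (hS : S ≤ standardFlag l k) :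
    Module.finrank ℂ (S.map (truncate h)) = Module.finrank ℂ S := by
  refine le_antisymm (Submodule.finrank_map_le _ _) ?_
  have h1 : S ≤ (S.map (truncate h)).map (coordIncl k l) := fun x hx =>
    ⟨_, ⟨x, hx, rfl⟩, coordIncl_truncate h le_rfl (hS hx)⟩
  exact (Submodule.finrank_mono h1).trans (Submodule.finrank_map_le _ _)

/-! ### Complete flags, indexed by the dimension -/

section Flag

variable {n : ℕ}

/-- The member of dimension `q` of a complete flag of `ℂ ^ (n + 1)`. -/
noncomputable def flagMember
    (V : MultiGrassmannian (fun _ : Fin n => n + 1) (fun q : Fin n => q.val + 1)) (q : ℕ) :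
    Submodule ℂ (Fin (n + 1) → ℂ) :=
  if q = 0 then ⊥ else if h : q - 1 < n then V.space ⟨q - 1, h⟩ else ⊤

variable {V : MultiGrassmannian (fun _ : Fin n => n + 1) (fun q : Fin n => q.val + 1)}

theorem flagMember_succ (q : Fin n) : flagMember V (q.val + 1) = V.space q := by
  rw [flagMember, if_neg (Nat.succ_ne_zero _), dif_pos (by simp)]
  rfl

theorem flagMember_zero : flagMember V 0 = ⊥ := if_pos rfl

theorem flagMember_last : flagMember V (n + 1) = ⊤ := by
  rw [flagMember, if_neg (Nat.succ_ne_zero _), dif_neg (by simp)]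

theorem finrank_flagMember {q : ℕ} (hq : q ≤ n + 1) :
    Module.finrank ℂ (flagMember V q) = q := by
  rcases q with _ | q
  · rw [flagMember_zero, finrank_bot]
  rcases hq.eq_or_lt with h | h
  · obtain rfl : q = n := by omega
    rw [flagMember_last, finrank_top, Module.finrank_fin_fun]
  · rw [flagMember_succ ⟨q, by omega⟩, V.finrank_space]

theorem flagMember_mono (hV : V ∈ flagVariety n) {q q' : ℕ} (h : q ≤ q') :
    flagMember V q ≤ flagMember V q' := by
  unfold flagMember
  split_ifs with h1 h2 h3 h4 h5 h6
  any_goals first | exact bot_le | exact le_top | omega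
  exact hV _ _ (Fin.le_def.2 (Nat.sub_le_sub_right h 1))

/-- For a flag it suffices to check the rank conditions of a permutation avoiding `4231` and `3412`
where they express an inclusion between a member of the flag and one of the standard flag. -/
theorem mem_schubertVariety_of_forall_eq_min {w : Equiv.Perm (Fin (n + 1))}
    (h4231 : AvoidsPattern w ![4, 2, 3, 1]) (h3412 : AvoidsPattern w ![3, 4, 1, 2])
    (hV : V ∈ flagVariety n)
    (h : ∀ (p : Fin (n + 1)) (q : Fin n),
      rankNum w (p.val + 1) (q.val + 1) = min (p.val + 1) (q.val + 1) →
      rankNum w (p.val + 1) (q.val + 1) ≤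
        Module.finrank ℂ ↥(standardFlag (n + 1) (p.val + 1) ⊓ V.space q)) :
    V ∈ schubertVariety w := by
  refine ⟨hV, fun p q => ?_⟩
  rw [← flagMember_succ]
  refine rankNum_le_of_forall_eq_min h4231 h3412
    (fun p q => Module.finrank ℂ ↥(standardFlag (n + 1) p ⊓ flagMember V q)) ?_ ?_ ?_ ?_ ?_
    (by omega) (by omega)
  · exact fun p q => Submodule.finrank_mono
      (inf_le_inf_right _ (standardFlag_mono _ (Nat.le_succ p)))
  · exact fun p q => Submodule.finrank_mono (inf_le_inf_left _ (flagMember_mono hV (Nat.le_succ q)))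
  · refine fun p q => Submodule.finrank_inf_le_add_one (standardFlag_mono _ (Nat.le_succ p)) ?_ _
    rw [finrank_standardFlag, finrank_standardFlag]
    omega
  · intro p q hq
    have h := Submodule.finrank_inf_le_add_one (flagMember_mono hV (Nat.le_succ q))
      (by rw [finrank_flagMember hq, finrank_flagMember hq.le]) (standardFlag (n + 1) p)
    rwa [inf_comm, inf_comm (flagMember V q)] at h
  · intro p q hp hq hmin
    rcases p with _ | p
    · rw [rankNum_zero_left]; exact Nat.zero_le _
    rcases q with _ | q
    · rw [rankNum_zero_right]; exact Nat.zero_le _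
    rcases hq.eq_or_lt with h1 | h1
    · obtain rfl : q = n := by omega
      rw [flagMember_last, inf_top_eq, finrank_standardFlag, hmin]
    · rw [flagMember_succ ⟨q, by omega⟩]
      exact h ⟨p, hp⟩ ⟨q, by omega⟩ hmin

theorem rankNum_le_finrank {w : Equiv.Perm (Fin (n + 1))} (hV : V ∈ schubertVariety w) {p q : ℕ}
    (hp : p ≤ n + 1) (hq : q ≤ n + 1) :
    rankNum w p q ≤ Module.finrank ℂ ↥(standardFlag (n + 1) p ⊓ flagMember V q) := by
  rcases p with _ | p
  · rw [rankNum_zero_left]; exact Nat.zero_le _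
  rcases q with _ | q
  · rw [rankNum_zero_right]; exact Nat.zero_le _
  rcases hq.eq_or_lt with h1 | h1
  · obtain rfl : q = n := by omega
    rw [flagMember_last, inf_top_eq, finrank_standardFlag, rankNum_top_right w hp]
    omega
  · rw [flagMember_succ ⟨q, by omega⟩]
    exact hV.2 ⟨p, hp⟩ ⟨q, by omega⟩

/-- A rank of p leaves F_p ∩ V_q no room to be smaller than F_p; the next lemma is the dual case. -/
theorem standardFlag_le_flagMember {w : Equiv.Perm (Fin (n + 1))} (hV : V ∈ schubertVariety w)
    {p q : ℕ} (hp : p ≤ n + 1) (hq : q ≤ n + 1) (h : p ≤ rankNum w p q) :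
    standardFlag (n + 1) p ≤ flagMember V q := by
  have h1 := h.trans (rankNum_le_finrank hV hp hq)
  rw [← inf_eq_left]
  refine Submodule.eq_of_le_of_finrank_le inf_le_left ?_
  rwa [finrank_standardFlag, min_eq_left hp]

theorem flagMember_le_standardFlag {w : Equiv.Perm (Fin (n + 1))} (hV : V ∈ schubertVariety w)
    {p q : ℕ} (hp : p ≤ n + 1) (hq : q ≤ n + 1) (h : q ≤ rankNum w p q) :
    flagMember V q ≤ standardFlag (n + 1) p := by
  have h1 := h.trans (rankNum_le_finrank hV hp hq)
  rw [← inf_eq_right]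
  refine Submodule.eq_of_le_of_finrank_le inf_le_right ?_
  rwa [finrank_flagMember hq]

/-! ### The subrepresentation determined by a flag -/

/-- The subspace at the vertex `(i, j)`, inside `ℂ ^ (n + 1)`, of the subrepresentation attached to
the flag `V`. -/
noncomputable def vertexSpace (w : Equiv.Perm (Fin (n + 1)))
    (V : MultiGrassmannian (fun _ : Fin n => n + 1) (fun q : Fin n => q.val + 1)) (i j : ℕ) :
    Submodule ℂ (Fin (n + 1) → ℂ) :=
  if spaceBound w i j ≤ flagBound w i j then standardFlag (n + 1) (flagBound w i j)
  else flagMember V (spaceBound w i j)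

theorem finrank_vertexSpace (w : Equiv.Perm (Fin (n + 1)))
    (V : MultiGrassmannian (fun _ : Fin n => n + 1) (fun q : Fin n => q.val + 1)) {i j : ℕ}
    (hi : i ≤ n + 1) (hj : j ≤ n + 1) :
    Module.finrank ℂ (vertexSpace w V i j) = dimEntry w i j := by
  have h1 := flagBound_le w i j
  have h2 := spaceBound_le w i j
  rw [dimEntry_eq]
  by_cases h : spaceBound w i j ≤ flagBound w i j
  · rw [vertexSpace, if_pos h, finrank_standardFlag]; omega
  · rw [vertexSpace, if_neg h, finrank_flagMember (h2.trans hj)]; omega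

variable {w : Equiv.Perm (Fin (n + 1))}

/-- The two candidates are comparable by `rankNum_bounds`. As a sum, the space is visibly monotone
in i and j. -/
theorem vertexSpace_eq_sup (h3412 : AvoidsPattern w ![3, 4, 1, 2]) (hV : V ∈ schubertVariety w)
    {i j : ℕ} (hi : i ≤ n + 1) (hj : j ≤ n + 1) :
    vertexSpace w V i j =
      standardFlag (n + 1) (flagBound w i j) ⊔ flagMember V (spaceBound w i j) := by
  have h1 := flagBound_le w i j
  have h2 := spaceBound_le w i j
  have h3 := rankNum_bounds h3412 hi hj
  rw [vertexSpace]
  split_ifs with h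
  · exact (sup_eq_left.2 (flagMember_le_standardFlag hV (by omega) (by omega) (by omega))).symm
  · exact (sup_eq_right.2 (standardFlag_le_flagMember hV (by omega) (by omega) (by omega))).symm

theorem vertexSpace_mono (h3412 : AvoidsPattern w ![3, 4, 1, 2]) (hV : V ∈ schubertVariety w)
    {i i' j j' : ℕ} (hi : i ≤ i') (hj : j ≤ j') (hi' : i' ≤ n + 1) (hj' : j' ≤ n + 1) :
    vertexSpace w V i j ≤ vertexSpace w V i' j' := by
  rw [vertexSpace_eq_sup h3412 hV (hi.trans hi') (hj.trans hj'),
    vertexSpace_eq_sup h3412 hV hi' hj']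
  exact sup_le_sup (standardFlag_mono _ (flagBound_mono w hi hj))
    (flagMember_mono hV.1 (spaceBound_mono w hi hj))

theorem vertexSpace_le_standardFlag (hV : V ∈ schubertVariety w) {i j : ℕ} (hi : i ≤ n + 1)
    (hj : j ≤ n + 1) : vertexSpace w V i j ≤ standardFlag (n + 1) i := by
  rw [vertexSpace]
  split_ifs with h
  · exact standardFlag_mono _ (flagBound_le w i j)
  · exact flagMember_le_standardFlag hV hi ((spaceBound_le w i j).trans hj)
      (rankNum_spaceBound w i j).ge

theorem vertexSpace_last (hV : V ∈ schubertVariety w) {j : ℕ} (hj : j ≤ n + 1) :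
    vertexSpace w V (n + 1) j = flagMember V j := by
  have h1 : spaceBound w (n + 1) j = j :=
    le_antisymm (spaceBound_le _ _ _) (le_spaceBound w le_rfl (rankNum_top_left w hj))
  have h2 := flagBound_le_rankNum w (n + 1) j
  rw [rankNum_top_left w hj] at h2
  rw [vertexSpace, h1]
  split_ifs with h
  -- In the tie, w permutes the first j entries and the rank condition forces F_j = V_j.
  · have h3 : flagBound w (n + 1) j = j := le_antisymm h2 h
    have h4 := rankNum_flagBound w (n + 1) j
    rw [h3] at h4 ⊢
    refine Submodule.eq_of_le_of_finrank_eq (standardFlag_le_flagMember hV hj hj h4.ge) ?_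
    rw [finrank_standardFlag, finrank_flagMember hj, min_eq_left hj]
  · rfl

theorem finrank_map_truncate_vertexSpace (hV : V ∈ schubertVariety w) (a : GridVertex n) :
    Module.finrank ℂ ((vertexSpace w V (a.row.val + 1) (a.col.val + 1)).map
      (truncate (Nat.succ_le_of_lt a.row.isLt))) = dimVector w a := by
  rw [finrank_map_truncate _ (vertexSpace_le_standardFlag hV (by omega) (by omega)),
    finrank_vertexSpace _ _ (by omega) (by omega)]
  rfl

/-- The subrepresentation of `gridRep n` attached to a flag in the Schubert variety. -/
noncomputable def subrepOfFlag (h3412 : AvoidsPattern w ![3, 4, 1, 2]) (V : schubertVariety w) :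
    quiverGrassmannian (gridRep n) (dimVector w) where
  val :=
    { space := fun a => (vertexSpace w V.1 (a.row.val + 1) (a.col.val + 1)).map
        (truncate (Nat.succ_le_of_lt a.row.isLt))
      finrank_space := finrank_map_truncate_vertexSpace V.2 }
  property := by
    rintro _ _ (⟨i, j⟩ | ⟨i, j, hj⟩)
    · rw [Submodule.map_le_iff_le_comap, Submodule.map_le_iff_le_comap]
      intro x hx
      have h := coordIncl_truncate (m := i.val + 1 + 1) (Nat.succ_le_of_lt i.castSucc.isLt)
        (Nat.succ_le_of_lt i.succ.isLt)
        (vertexSpace_le_standardFlag V.2 (Nat.succ_le_of_lt i.castSucc.isLt) (by omega) hx)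
      refine ⟨x, vertexSpace_mono h3412 V.2 (by simp) le_rfl (by simp) (by simp) hx, ?_⟩
      exact h.symm
    · exact (Submodule.map_id _).trans_le (Submodule.map_mono
        (vertexSpace_mono h3412 V.2 le_rfl (by simp) (by simp; omega) (by simp)))

/-! ### The flag of a subrepresentation -/

theorem dimVector_last (j : Fin n) : dimVector w ⟨Fin.last n, j⟩ = j.val + 1 := by
  have h : rankNum w (n + 1) (j.val + 1) = j.val + 1 := rankNum_top_left w (by omega)
  rw [dimVector, dimEntry_eq]
  simp only [Fin.val_last]
  rw [max_bounds_eq_rankNum w (Or.inl (by omega)), h]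

/-- The last row of a subrepresentation. -/
def lastRow (N : MultiGrassmannian (gridRep n).dim (dimVector w)) :
    MultiGrassmannian (fun _ : Fin n => n + 1) (fun q : Fin n => q.val + 1) where
  space j := N.space ⟨Fin.last n, j⟩
  finrank_space j := (N.finrank_space ⟨Fin.last n, j⟩).trans (dimVector_last j)

/-- The subspace `N a`, viewed inside `ℂ ^ (n + 1)`. -/
noncomputable def ambientSpace (N : MultiGrassmannian (gridRep n).dim (dimVector w))
    (a : GridVertex n) : Submodule ℂ (Fin (n + 1) → ℂ) :=
  (N.space a).map (coordIncl (a.row.val + 1) (n + 1))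

variable {N : MultiGrassmannian (gridRep n).dim (dimVector w)}

theorem ambientSpace_last (j : Fin n) : ambientSpace N ⟨Fin.last n, j⟩ = (lastRow N).space j :=
  (congrArg (fun f => (N.space ⟨Fin.last n, j⟩).map f) (coordIncl_self (n + 1))).trans
    (Submodule.map_id _)

theorem ambientSpace_le_standardFlag (a : GridVertex n) :
    ambientSpace N a ≤ standardFlag (n + 1) (a.row.val + 1) := by
  rintro _ ⟨x, _, rfl⟩
  exact coordIncl_mem_standardFlag x

theorem map_truncate_ambientSpace (a : GridVertex n) :
    (ambientSpace N a).map (truncate (Nat.succ_le_of_lt a.row.isLt)) = N.space a := by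
  have h : ∀ S : Submodule ℂ (Fin (a.row.val + 1) → ℂ),
      (S.map (coordIncl (a.row.val + 1) (n + 1))).map (truncate (Nat.succ_le_of_lt a.row.isLt)) =
        S := fun S => by
    rw [← Submodule.map_comp, show truncate _ ∘ₗ coordIncl _ _ = LinearMap.id from
      LinearMap.ext fun x => truncate_coordIncl (Nat.succ_le_of_lt a.row.isLt) x, Submodule.map_id]
  exact h (N.space a)

theorem finrank_ambientSpace (a : GridVertex n) :
    Module.finrank ℂ (ambientSpace N a) = dimEntry w (a.row.val + 1) (a.col.val + 1) := by
  have h : ∀ S : Submodule ℂ (Fin (a.row.val + 1) → ℂ),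
      Module.finrank ℂ (S.map (coordIncl (a.row.val + 1) (n + 1))) = Module.finrank ℂ S := fun S =>
    (Submodule.equivMapOfInjective _ (coordIncl_injective a.row.isLt) S).finrank_eq.symm
  exact (h (N.space a)).trans (N.finrank_space a)

theorem finrank_ambientSpace_of_eq_min (a : GridVertex n)
    (h : rankNum w (a.row.val + 1) (a.col.val + 1) = min (a.row.val + 1) (a.col.val + 1)) :
    Module.finrank ℂ (ambientSpace N a) = min (a.row.val + 1) (a.col.val + 1) := by
  rw [finrank_ambientSpace, dimEntry_eq, max_bounds_eq_rankNum w (Or.inl h), h]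

theorem ambientSpace_mono_row (hN : N ∈ quiverGrassmannian (gridRep n) (dimVector w))
    (j : Fin n) :
    Monotone fun i : Fin (n + 1) => ambientSpace N ⟨i, j⟩ := by
  rw [Fin.monotone_iff_le_succ]
  intro i
  have h := hN _ _ (GridArrow.down i j)
  have h2 := Submodule.map_mono (f := coordIncl (i.val + 1 + 1) (n + 1)) h
  refine le_trans (le_of_eq ?_) h2
  refine Eq.trans ?_ (Submodule.map_comp _ _ _)
  exact congrArg (fun f => (N.space ⟨i.castSucc, j⟩).map f)
    (coordIncl_comp (Nat.le_succ (i.val + 1))).symm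

theorem ambientSpace_mono_col (hN : N ∈ quiverGrassmannian (gridRep n) (dimVector w))
    (i : Fin (n + 1)) :
    Monotone fun j : Fin n => ambientSpace N ⟨i, j⟩ := by
  have key : ∀ (c : ℕ) (j j' : Fin n), j'.val = j.val + c →
      ambientSpace N ⟨i, j⟩ ≤ ambientSpace N ⟨i, j'⟩ := by
    intro c j
    induction c with
    | zero =>
      intro j' h
      rw [Fin.ext h]
    | succ c ih =>
      rintro ⟨_, hj'⟩ rfl
      have hj : j.val + c < n := (Nat.lt_succ_self _).trans hj'
      have h := hN _ _ (GridArrow.right i ⟨j.val + c, hj⟩ hj')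
      exact (ih ⟨j.val + c, hj⟩ rfl).trans (Submodule.map_mono fun x hx => h ⟨x, hx, rfl⟩)
  intro j j' h
  obtain ⟨c, hc⟩ := Nat.exists_eq_add_of_le (Fin.le_def.1 h)
  exact key c j j' hc

/-- Where the rank is min(p,q), the space N(p,q) has that dimension and lies in F_p and, through the
downward arrows, in V_q, so F_p ∩ V_q is large enough. -/
theorem lastRow_mem_schubertVariety (hN : N ∈ quiverGrassmannian (gridRep n) (dimVector w))
    (h4231 : AvoidsPattern w ![4, 2, 3, 1])
    (h3412 : AvoidsPattern w ![3, 4, 1, 2]) : lastRow N ∈ schubertVariety w := by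
  refine mem_schubertVariety_of_forall_eq_min h4231 h3412 ?_ ?_
  · intro q q' h
    have := ambientSpace_mono_col hN (Fin.last n) h
    simpa only [ambientSpace_last] using this
  · intro p q h
    rw [h, ← finrank_ambientSpace_of_eq_min (N := N) ⟨p, q⟩ h]
    refine Submodule.finrank_mono (le_inf (ambientSpace_le_standardFlag _) ?_)
    exact (ambientSpace_mono_row hN q (Fin.le_last p)).trans (ambientSpace_last q).le

/-- A subrepresentation is determined by its last row: N(p,j) fills F_p or N(i,q) fills V_q for
dimension reasons, the arrows carry it into N(i,j), and the dimensions agree there. -/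
theorem vertexSpace_lastRow (hN : N ∈ quiverGrassmannian (gridRep n) (dimVector w))
    (a : GridVertex n) :
    vertexSpace w (lastRow N) (a.row.val + 1) (a.col.val + 1) = ambientSpace N a := by
  refine Submodule.eq_of_le_of_finrank_eq ?_ ?_
  swap
  · rw [finrank_vertexSpace _ _ (by omega) (by omega), finrank_ambientSpace]
  have h1 := flagBound_le w (a.row.val + 1) (a.col.val + 1)
  have h2 := spaceBound_le w (a.row.val + 1) (a.col.val + 1)
  have h3 := rankNum_flagBound w (a.row.val + 1) (a.col.val + 1)
  have h4 := rankNum_spaceBound w (a.row.val + 1) (a.col.val + 1)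
  rw [vertexSpace]
  generalize flagBound w (a.row.val + 1) (a.col.val + 1) = p at *
  generalize spaceBound w (a.row.val + 1) (a.col.val + 1) = q at *
  split_ifs with h
  -- There is no vertex in row 0, so F_0 = 0 is treated apart.
  · rcases p with _ | p
    · have : standardFlag (n + 1) 0 = ⊥ := by
        rw [← Submodule.finrank_eq_zero (R := ℂ), finrank_standardFlag, Nat.zero_min]
      rw [this]; exact bot_le
    have h5 := rankNum_le_right w (p + 1) (a.col.val + 1)
    refine le_trans (le_of_eq ?_) (ambientSpace_mono_row hN a.col
      (show (⟨p, by omega⟩ : Fin (n + 1)) ≤ a.row from Fin.le_def.2 (by simp only; omega)))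
    refine (Submodule.eq_of_le_of_finrank_eq (ambientSpace_le_standardFlag ⟨⟨p, by omega⟩, a.col⟩) ?_).symm
    rw [finrank_ambientSpace_of_eq_min _ (by simp only; omega), finrank_standardFlag]
    simp only
    omega
  · rcases q with _ | q
    · omega
    have h5 := rankNum_le_left w (a.row.val + 1) (q + 1)
    have hq : q < n := by omega
    refine le_trans (le_of_eq ?_) (ambientSpace_mono_col hN a.row
      (show (⟨q, hq⟩ : Fin n) ≤ a.col from Fin.le_def.2 (by simp only; omega)))
    rw [flagMember_succ ⟨q, hq⟩]
    refine (Submodule.eq_of_le_of_finrank_eq ((ambientSpace_mono_row hN _ (Fin.le_last _)).trans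
      (ambientSpace_last _).le) ?_).symm
    rw [finrank_ambientSpace_of_eq_min _ (by simp only; omega)]
    refine Eq.trans ?_ ((lastRow N).finrank_space ⟨q, hq⟩).symm
    simp only
    omega

end Flag

/-! ### The isomorphism -/

section Iso

variable {n : ℕ} {w : Equiv.Perm (Fin (n + 1))}

/-- The bijection between the quiver Grassmannian and the Schubert variety. -/
noncomputable def quiverGrassmannianEquiv (h4231 : AvoidsPattern w ![4, 2, 3, 1])
    (h3412 : AvoidsPattern w ![3, 4, 1, 2]) :
    quiverGrassmannian (gridRep n) (dimVector w) ≃ schubertVariety w where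
  toFun N := ⟨lastRow N.1, lastRow_mem_schubertVariety N.2 h4231 h3412⟩
  invFun := subrepOfFlag h3412
  left_inv N := by
    refine Subtype.ext (MultiGrassmannian.ext (funext fun a => ?_))
    refine Eq.trans ?_ (map_truncate_ambientSpace (N := N.1) a)
    rw [← vertexSpace_lastRow N.2 a]
    rfl
  right_inv V := by
    refine Subtype.ext (MultiGrassmannian.ext (funext fun j => ?_))
    have h := vertexSpace_last V.2 (j := j.val + 1) (by omega)
    rw [flagMember_succ] at h
    rw [← h]
    exact Submodule.map_id _

theorem hasPolynomialLift_quiverGrassmannianEquiv (h4231 : AvoidsPattern w ![4, 2, 3, 1])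
    (h3412 : AvoidsPattern w ![3, 4, 1, 2]) :
    MultiGrassmannian.HasPolynomialLift (quiverGrassmannianEquiv h4231 h3412) :=
  .of_components fun j => Or.inl ⟨⟨Fin.last n, j⟩, RelEmbedding.refl _, (dimVector_last j).symm,
    fun _ => (Submodule.map_id _).symm⟩

/-- Whether a vertex carries F_p or V_q depends on w alone, not on the flag. So each component is
constant or the truncation of one fixed member of the flag. -/
theorem hasPolynomialLift_quiverGrassmannianEquiv_symm (h4231 : AvoidsPattern w ![4, 2, 3, 1])
    (h3412 : AvoidsPattern w ![3, 4, 1, 2]) :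
    MultiGrassmannian.HasPolynomialLift (quiverGrassmannianEquiv h4231 h3412).symm := by
  refine .of_components fun a => ?_
  by_cases h : spaceBound w (a.row.val + 1) (a.col.val + 1) ≤
    flagBound w (a.row.val + 1) (a.col.val + 1)
  · refine Or.inr ⟨(standardFlag (n + 1) (flagBound w (a.row.val + 1) (a.col.val + 1))).map
      (truncate (Nat.succ_le_of_lt a.row.isLt)), fun V => ?_⟩
    change (vertexSpace w V.1 _ _).map _ = _
    rw [vertexSpace, if_pos h]
  · have hq := spaceBound_le w (a.row.val + 1) (a.col.val + 1)
    -- The bound q is positive, as it exceeds `flagBound`, and V_q is stored at index q - 1.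
    have hlt : spaceBound w (a.row.val + 1) (a.col.val + 1) - 1 < n := by omega
    refine Or.inl ⟨⟨_, hlt⟩, Fin.castLEOrderEmb (Nat.succ_le_of_lt a.row.isLt), ?_, fun V => ?_⟩
    · rw [dimVector, dimEntry_eq]
      simp only
      omega
    · change (vertexSpace w V.1 _ _).map _ = _
      rw [vertexSpace, if_neg h, flagMember, if_neg (by omega), dif_pos hlt]
      rfl

end Iso

theorem theorem3 (n : ℕ) (w : Equiv.Perm (Fin (n + 1)))
    (h4231 : AvoidsPattern w ![4, 2, 3, 1]) (h3412 : AvoidsPattern w ![3, 4, 1, 2]) :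
    ∃ ψ : VarietyIso (quiverGrassmannian (gridRep n) (dimVector w)) (schubertVariety w),
      ∀ (N : quiverGrassmannian (gridRep n) (dimVector w)) (j : Fin n),
        (ψ.toHomeomorph N).1.space j = N.1.space ⟨Fin.last n, j⟩ :=
  ⟨.ofPolynomialLift _ (hasPolynomialLift_quiverGrassmannianEquiv h4231 h3412)
    (hasPolynomialLift_quiverGrassmannianEquiv_symm h4231 h3412), fun _ _ => rfl⟩
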